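/- Let $\sigma\ge 2$ be an integer and let $c,\epsilon$ be real constants with $1-\epsilon>c>\epsilon>0$. For a string $s$ of length $n$ over an alphabet of size $\sigma$ let $H_0(s)=\frac1n\sum_{a\in s}n_a\log_2\frac{n}{n_a}$, where $n_a$ is the number of occurrences of $a$ in $s$ (and $H_0=0$ for the empty string), and let $H_k(s)=\frac1n\sum_{|w|=k}|w_s|\,H_0(w_s)$ for $k\ge 1$, where $w_s$ is the concatenation of the characters that immediately follow the occurrences of $w$ in $s$. In the Multipass model, a decompression algorithm has its input, a string of bits, on a one-way read-only tape that is rewound whenever its end is reached, and it writes to a write-only output stream. In the W-Streams model, the tape has a fixed finite alphabet and initially contains the input; in each pass the algorithm reads the tape from left to right and replaces its contents by something at most a constant factor larger, and the result is delivered either as the final contents of the tape or through a write-only output stream. In both models the memory is a string of bits, which persists between passes, and the algorithm is deterministic; its transition function is otherwise arbitrary and may depend on $n$, the length of the string to be recovered. Let $A$ be a decompression algorithm in the Multipass model or in the W-Streams model. Then for all constants $C_{\mathrm{mem}}, C_{\mathrm{pass}}, C_{\mathrm{bits}}$ and $b\in\mathbb N$ (and every constant bounding the expansion of the tape in each pass,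 in the W-Streams model) the following holds for every sufficiently large $n$, with $k=\lceil (c+\epsilon/2)\log_\sigma n\rceil$: there is a string $s$ of length $n$ over the alphabet such that there is no string $e$ of at most $C_{\mathrm{bits}}\left(nH_k(s)+\sigma^k n^{1-c-\epsilon}\right)$ bits from which $A$ recovers $s$ using at most $C_{\mathrm{mem}}\,n^c$ bits of memory and at most $C_{\mathrm{pass}}(\log n)^b$ passes. That is, with $O(n^c)$ bits of memory and $\log^{O(1)}n$ passes, $s$ cannot, in the worst case, be recovered from $O\left(nH_k(s)+\sigma^k n^{1-c-\epsilon}\right)$ bits. -/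

import Mathlib

open Filter

/-! ### Empirical entropy -/

/-- The 0th-order empirical entropy of a string:
`(1 / n) * ∑ n_a * log₂ (n / n_a)` over the characters `a` occurring in it
(it is `0` for the empty string). -/
noncomputable def H0 {σ : ℕ} (s : List (Fin σ)) : ℝ :=
  (1 / (s.length : ℝ)) *
    ∑ a ∈ s.toFinset, (s.count a : ℝ) * Real.logb 2 ((s.length : ℝ) / (s.count a : ℝ))

/-- The string `w_s`: the concatenation of the characters that immediately follow the (possibly
overlapping) occurrences of `w` in `s`.  An occurrence at the very end of `s` contributes
nothing. -/
def followers {σ : ℕ} (w s : List (Fin σ)) : List (Fin σ) :=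
  (s.tails.filter (fun t => w.isPrefixOf t)).flatMap (fun t => (t.drop w.length).take 1)

/-- The `k`th-order empirical entropy `(1 / n) * ∑_{|w| = k} |w_s| * H₀(w_s)`.
(For `k = 0` the only context is the empty word, whose followers are all of `s`.) -/
noncomputable def Hk {σ : ℕ} (k : ℕ) (s : List (Fin σ)) : ℝ :=
  (1 / (s.length : ℝ)) *
    ∑ w : Fin k → Fin σ,
      ((followers (List.ofFn w) s).length : ℝ) * H0 (followers (List.ofFn w) s)

/-- What the head meets in one pass over a tape: its symbols from left to right, then an end
marker `none`. -/
def markEnd {Γ : Type} (tape : List Γ) : List (Option Γ) :=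
  tape.map some ++ [none]

/-! ### The Multipass model -/

/-- A decompression algorithm in the Multipass model.  The memory is a string of bits.  The
encoding, a string of bits, stands on a one-way read-only tape which is rewound whenever its end
is reached.  From the contents of the memory and the symbol just read (`none` is the end of the
tape), `step` gives the new contents of the memory and a string appended to a write-only output.
The transition function is arbitrary: no bound on time and no computability is imposed. -/
structure MultipassDecoder (σ : ℕ) where
  start : List Bool
  step : List Bool → Option Bool → List Bool × List (Fin σ)

namespace MultipassDecoder

variable {σ : ℕ}

/-- Read the given symbols, starting with memory `q`: final memory, and what is output. -/
def scan (A : MultipassDecoder σ) :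
    List Bool → List (Option Bool) → List Bool × List (Fin σ)
  | q, [] => (q, [])
  | q, x :: xs =>
      let r := A.step q x
      let t := A.scan r.1 xs
      (t.1, r.2 ++ t.2)

/-- The memory, and everything output so far, after `i` passes over the encoding `e`. -/
def afterPasses (A : MultipassDecoder σ) (e : List Bool) : ℕ → List Bool × List (Fin σ)
  | 0 => (A.start, [])
  | i + 1 =>
      let C := A.afterPasses e i
      let t := A.scan C.1 (markEnd e)
      (t.1, C.2 ++ t.2)

/-- `A` recovers `s` from the encoding `e` in at most `P` passes, its memory containing at most
`M` bits at any time. -/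
def Recovers (A : MultipassDecoder σ) (M P : ℝ) (e : List Bool) (s : List (Fin σ)) : Prop :=
  ∃ p : ℕ, (p : ℝ) ≤ P ∧
    (∀ i < p, ∀ l, l <+: markEnd e →
      ((A.scan (A.afterPasses e i).1 l).1.length : ℝ) ≤ M) ∧
    (A.afterPasses e p).2 = s

end MultipassDecoder

/-! ### The W-Streams model -/

/-- A decompression algorithm in the W-Streams model, with tape alphabet `Γ`.  The memory is a
string of bits.  The tape initially contains the encoding, a string of bits.  In each pass the
tape is read from left to right and its contents are replaced: from the contents of the memory
and the symbol just read (`none` is the end of the tape), `step` gives the new contents of the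
memory, a string appended to the new contents of the tape, and a string appended to a write-only
output.  The transition function is arbitrary: no bound on time and no computability is
imposed. -/
structure WStreamsDecoder (σ : ℕ) (Γ : Type) where
  bit : Bool ↪ Γ
  char : Fin σ ↪ Γ
  start : List Bool
  step : List Bool → Option Γ → List Bool × List Γ × List (Fin σ)

namespace WStreamsDecoder

variable {σ : ℕ} {Γ : Type}

/-- Read the given symbols, starting with memory `q`: final memory, what is written on the tape,
and what is output. -/
def scan (A : WStreamsDecoder σ Γ) :
    List Bool → List (Option Γ) → List Bool × List Γ × List (Fin σ)
  | q, [] => (q, [], [])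
  | q, x :: xs =>
      let r := A.step q x
      let t := A.scan r.1 xs
      (t.1, r.2.1 ++ t.2.1, r.2.2 ++ t.2.2)

/-- The memory, the contents of the tape, and everything output so far, after `i` passes, when
the tape initially contains the encoding `e`. -/
def afterPasses (A : WStreamsDecoder σ Γ) (e : List Bool) :
    ℕ → List Bool × List Γ × List (Fin σ)
  | 0 => (A.start, e.map A.bit, [])
  | i + 1 =>
      let C := A.afterPasses e i
      let t := A.scan C.1 (markEnd C.2.1)
      (t.1, t.2.1, C.2.2 ++ t.2.2)

/-- `A` recovers `s` from the encoding `e` in at most `P` passes, its memory containing at most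
`M` bits at any time, and each pass expanding the contents of the tape (end marker included) by
at most the factor `G`.  The string `s` may be delivered either as the final contents of the tape
or through the output. -/
def Recovers (A : WStreamsDecoder σ Γ) (G M P : ℝ) (e : List Bool) (s : List (Fin σ)) : Prop :=
  ∃ p : ℕ, (p : ℝ) ≤ P ∧
    (∀ i < p, ∀ l, l <+: markEnd (A.afterPasses e i).2.1 →
      ((A.scan (A.afterPasses e i).1 l).1.length : ℝ) ≤ M) ∧
    (∀ i < p, ((A.afterPasses e (i + 1)).2.1.length : ℝ) ≤
      G * (((A.afterPasses e i).2.1.length : ℝ) + 1)) ∧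
    ((A.afterPasses e p).2.1 = s.map A.char ∨ (A.afterPasses e p).2.2 = s)

end WStreamsDecoder

/-- The context length `k = ⌈(c + ε / 2) * log_σ n⌉`. -/
noncomputable def contextLength (σ : ℕ) (c ε : ℝ) (n : ℕ) : ℕ :=
  ⌈(c + ε / 2) * Real.logb σ n⌉₊

/-- The quantity `n * H_k(s) + σ ^ k * n ^ (1 - c - ε)` for `n = |s|` and
`k = ⌈(c + ε / 2) * log_σ n⌉`. -/
noncomputable def targetBits {σ : ℕ} (c ε : ℝ) (s : List (Fin σ)) : ℝ :=
  (s.length : ℝ) * Hk (contextLength σ c ε s.length) s +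
    (σ : ℝ) ^ contextLength σ c ε s.length * (s.length : ℝ) ^ (1 - c - ε)

/-! The hard strings are periodic. Put ρ = n^(ε/64) and u = n^c, so that ρ eventually dominates
every constant and polylogarithm. The period is r ≈ uρ^16, while σ^k is at least uρ^32. In a random
cyclic word of length r, the expected number of positions whose length-k factor reappears is at most
r²/σ^k ≤ r/ρ^16 (`card_few_repeatedPositions`). Elsewhere the context determines the next character,
so for at least half of the words t the string repeating t has nH_k at most about n log n/ρ^16
(`length_mul_Hk_periodicString_le`), and the permitted encoding has at most n/ρ^8 bits.

Such an encoding is too short. The string contains many copies of t, and the positions read in the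
encoding depend monotonically on the positions written. Hence some copy of a rotation of t comes
from a stretch of about r/ρ² bits of the encoding (`exists_short_block`). This stretch, together
with one memory content and two cuts for each pass, determines t (`exists_tape_source`,
`exists_code`). The whole description takes fewer than r - 1 bits, so fewer than half of all cyclic
words have one (`two_mul_card_codes_lt`). Some word with few repeated positions is left over.

A Multipass decoder is a W-Streams decoder that copies its tape. -/

/-! ### Cyclic words with few repeated factors -/

/-- The positions of the cyclic word `t` at which the cyclic factor of length `k` occurs elsewhere
too. -/
noncomputable def repeatedPositions {σ r : ℕ} [NeZero r] (k : ℕ) (t : ZMod r → Fin σ) :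
    Finset (ZMod r) := by
  classical
  exact Finset.univ.filter fun i => ∃ j, j ≠ i ∧ ∀ l < k, t (i + (l : ℕ)) = t (j + (l : ℕ))

theorem mem_repeatedPositions {σ r : ℕ} [NeZero r] {k : ℕ} {t : ZMod r → Fin σ} {i : ZMod r} :
    i ∈ repeatedPositions k t ↔
      ∃ j, j ≠ i ∧ ∀ l < k, t (i + (l : ℕ)) = t (j + (l : ℕ)) := by
  simp [repeatedPositions]

open Classical in
-- The letters outside the window of length k at j determine those inside, from left to right: the
-- letter at j + l equals the one at i + l, which lies either before the window or earlier in it.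
-- The bound `hk` keeps the window from wrapping around to i. Overlapping factors are allowed.
theorem card_equal_factors_aux {σ r : ℕ} [NeZero r] {k : ℕ} {i j : ZMod r} (hij : i ≠ j)
    (hk : (j - i).val + k ≤ r) :
    (Finset.univ.filter fun t : ZMod r → Fin σ =>
      ∀ l < k, t (i + (l : ℕ)) = t (j + (l : ℕ))).card * σ ^ k ≤ σ ^ r := by
  have hd : 0 < (j - i).val := by
    rw [Nat.pos_iff_ne_zero, Ne, ZMod.val_eq_zero, sub_eq_zero]
    exact fun h => hij h.symm
  set d := (j - i).val with hd_def
  have hdj : ((d : ℕ) : ZMod r) = j - i := ZMod.natCast_zmod_val _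
  have cast_inj : ∀ a b : ℕ, a < r → b < r → ((a : ℕ) : ZMod r) = (b : ℕ) → a = b := by
    intro a b ha hb h
    have := (ZMod.natCast_eq_natCast_iff' a b r).1 h
    rwa [Nat.mod_eq_of_lt ha, Nat.mod_eq_of_lt hb] at this
  let W : Finset (ZMod r) := (Finset.range k).image fun l : ℕ => j + (l : ZMod r)
  have hW : W.card = k := by
    rw [Finset.card_image_of_injOn, Finset.card_range]
    intro a ha b hb h
    simp only [Finset.coe_range, Set.mem_Iio] at ha hb
    exact cast_inj a b (by omega) (by omega) (add_left_cancel h)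
  have hinj : (Finset.univ.filter fun t : ZMod r → Fin σ =>
      ∀ l < k, t (i + (l : ℕ)) = t (j + (l : ℕ))).card ≤
      (Finset.univ : Finset ({x // x ∉ W} → Fin σ)).card := by
    apply Finset.card_le_card_of_injOn (fun t x => t x.1) (fun _ _ => Finset.mem_univ _)
    intro t ht t' ht' h
    simp only [Finset.coe_filter, Finset.mem_univ, true_and, Set.mem_ofPred_eq] at ht ht'
    have hoff : ∀ x, x ∉ W → t x = t' x := fun x hx => congrFun h ⟨x, hx⟩
    have hon : ∀ l, l < k → t (j + (l : ℕ)) = t' (j + (l : ℕ)) := by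
      intro l
      induction l using Nat.strong_induction_on with
      | _ l ih =>
        intro hl
        rw [← ht l hl, ← ht' l hl]
        rcases le_or_gt d l with hdl | hdl
        · have e : i + ((l : ℕ) : ZMod r) = j + ((l - d : ℕ) : ZMod r) := by
            rw [Nat.cast_sub hdl, hdj]; ring
          rw [e]
          exact ih _ (by omega) (by omega)
        · apply hoff
          intro hmem
          obtain ⟨l', hl', e⟩ := Finset.mem_image.1 hmem
          rw [Finset.mem_range] at hl'
          have e2 : ((d + l' : ℕ) : ZMod r) = (l : ℕ) := by
            rw [Nat.cast_add, hdj]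
            linear_combination e
          have := cast_inj _ _ (by omega) (by omega) e2
          omega
    funext x
    by_cases hx : x ∈ W
    · obtain ⟨l, hl, rfl⟩ := Finset.mem_image.1 hx
      exact hon l (Finset.mem_range.1 hl)
    · exact hoff x hx
  have hcard : (Finset.univ : Finset ({x // x ∉ W} → Fin σ)).card = σ ^ (r - k) := by
    rw [Finset.card_univ, Fintype.card_fun, Fintype.card_fin, Fintype.card_subtype_compl,
      ZMod.card, Fintype.card_coe, hW]
  calc _ ≤ σ ^ (r - k) * σ ^ k := Nat.mul_le_mul_right _ (hcard ▸ hinj)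
    _ = σ ^ r := by rw [← pow_add]; congr 1; omega

open Classical in
/-- A cyclic word of length `r` has equal factors at two given positions with probability at most
`σ ^ (-k)`. -/
theorem card_equal_factors {σ r : ℕ} [NeZero r] {k : ℕ} {i j : ZMod r} (hij : i ≠ j)
    (hk : 2 * k ≤ r) :
    (Finset.univ.filter fun t : ZMod r → Fin σ =>
      ∀ l < k, t (i + (l : ℕ)) = t (j + (l : ℕ))).card * σ ^ k ≤ σ ^ r := by
  -- If the window at j wraps around to i, then the one at i does not reach j, because 2k ≤ r; the
  -- two positions exchange roles.
  by_cases h : (j - i).val + k ≤ r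
  · exact card_equal_factors_aux hij h
  · have hne : j - i ≠ 0 := sub_ne_zero.2 hij.symm
    have hneg : (i - j).val = r - (j - i).val := by
      rw [← neg_sub j i, ZMod.neg_val, if_neg hne]
    have := card_equal_factors_aux (σ := σ) (k := k) hij.symm (by omega)
    simpa only [eq_comm] using this

open Classical in
/-- At least half of the cyclic words have at most twice the expected number of repeated
positions. -/
theorem card_few_repeatedPositions {σ r : ℕ} [NeZero r] {k : ℕ} (hk : 2 * k ≤ r) :
    σ ^ r ≤ 2 * (Finset.univ.filter fun t : ZMod r → Fin σ =>
      (repeatedPositions k t).card * σ ^ k ≤ 2 * r ^ 2).card := by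
  have hr : 0 < r := NeZero.pos r
  have hsum : (∑ t : ZMod r → Fin σ, (repeatedPositions k t).card) * σ ^ k ≤ r ^ 2 * σ ^ r := by
    have h1 : ∀ t : ZMod r → Fin σ, (repeatedPositions k t).card ≤
        ∑ x ∈ (Finset.univ : Finset (ZMod r × ZMod r)).filter (fun x => x.1 ≠ x.2),
          if ∀ l < k, t (x.1 + (l : ℕ)) = t (x.2 + (l : ℕ)) then 1 else 0 := by
      intro t
      rw [← Finset.card_filter]
      -- One partner for each repeated position injects these positions into the ordered pairs with
      -- equal factors.
      choose! g hg using fun i (hi : i ∈ repeatedPositions k t) => mem_repeatedPositions.1 hi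
      apply Finset.card_le_card_of_injOn (fun i => (i, g i))
      · intro i hi
        have := hg i hi
        simp only [Finset.coe_filter, Finset.mem_filter, Finset.mem_univ, true_and,
          Set.mem_ofPred_eq]
        exact ⟨this.1.symm, this.2⟩
      · intro a _ b _ h
        exact (Prod.ext_iff.1 h).1
    calc (∑ t : ZMod r → Fin σ, (repeatedPositions k t).card) * σ ^ k
        ≤ (∑ t : ZMod r → Fin σ,
          ∑ x ∈ (Finset.univ : Finset (ZMod r × ZMod r)).filter (fun x => x.1 ≠ x.2),
          if ∀ l < k, t (x.1 + (l : ℕ)) = t (x.2 + (l : ℕ)) then 1 else 0) * σ ^ k :=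
          Nat.mul_le_mul_right _ (Finset.sum_le_sum fun t _ => h1 t)
      _ = ∑ x ∈ (Finset.univ : Finset (ZMod r × ZMod r)).filter (fun x => x.1 ≠ x.2),
          (Finset.univ.filter fun t : ZMod r → Fin σ =>
            ∀ l < k, t (x.1 + (l : ℕ)) = t (x.2 + (l : ℕ))).card * σ ^ k := by
          rw [Finset.sum_comm, Finset.sum_mul]
          simp only [Finset.card_filter]
      _ ≤ ∑ x ∈ (Finset.univ : Finset (ZMod r × ZMod r)).filter (fun x => x.1 ≠ x.2), σ ^ r :=
          Finset.sum_le_sum fun x hx => card_equal_factors (Finset.mem_filter.1 hx).2 hk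
      _ ≤ ∑ x : ZMod r × ZMod r, σ ^ r :=
          Finset.sum_le_sum_of_subset (Finset.filter_subset _ _)
      _ = r ^ 2 * σ ^ r := by
          rw [Finset.sum_const, Finset.card_univ, Fintype.card_prod, ZMod.card, smul_eq_mul, sq]
  by_contra hcon
  push Not at hcon
  set T := Finset.univ.filter fun t : ZMod r → Fin σ =>
      (repeatedPositions k t).card * σ ^ k ≤ 2 * r ^ 2 with hT
  have hcompl : T.card + Tᶜ.card = σ ^ r := by
    rw [Finset.card_add_card_compl, Fintype.card_fun, ZMod.card, Fintype.card_fin]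
  -- Markov's inequality.
  have h2 : Tᶜ.card * (2 * r ^ 2) ≤ r ^ 2 * σ ^ r := by
    refine le_trans ?_ hsum
    rw [Finset.sum_mul, ← smul_eq_mul, ← Finset.sum_const]
    refine le_trans (Finset.sum_le_sum fun t ht => ?_)
      (Finset.sum_le_sum_of_subset (Finset.subset_univ Tᶜ))
    simp only [hT, Finset.mem_compl, Finset.mem_filter, Finset.mem_univ, true_and, not_le] at ht
    exact ht.le
  have h3 : 0 < r ^ 2 := by positivity
  have h4 : Tᶜ.card * 2 ≤ σ ^ r := by
    refine Nat.le_of_mul_le_mul_left ?_ h3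
    calc r ^ 2 * (Tᶜ.card * 2) = Tᶜ.card * (2 * r ^ 2) := by ring
      _ ≤ _ := h2
  omega

/-! ### Entropy charged to ambiguous contexts -/

theorem length_mul_H0 {σ : ℕ} (u : List (Fin σ)) :
    (u.length : ℝ) * H0 u =
      ∑ a ∈ u.toFinset, (u.count a : ℝ) * Real.logb 2 ((u.length : ℝ) / (u.count a : ℝ)) := by
  rcases u.eq_nil_or_concat with rfl | ⟨_, _, rfl⟩
  · simp
  · rw [H0, ← mul_assoc, mul_one_div_cancel, one_mul]
    simp only [List.concat_eq_append, List.length_append, List.length_singleton]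
    positivity

theorem length_mul_H0_le {σ : ℕ} (u : List (Fin σ)) {n : ℕ} (hn : u.length ≤ n) :
    (u.length : ℝ) * H0 u ≤ u.length * Real.logb 2 n := by
  rw [length_mul_H0]
  have hsum : (u.length : ℝ) = ∑ a ∈ u.toFinset, (u.count a : ℝ) := by
    rw [← Nat.cast_sum, List.sum_toFinset_count_eq_length]
  conv_rhs => rw [hsum, Finset.sum_mul]
  refine Finset.sum_le_sum fun a ha => mul_le_mul_of_nonneg_left ?_ (Nat.cast_nonneg _)
  have hc : 1 ≤ u.count a := List.one_le_count_iff.2 (List.mem_toFinset.1 ha)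
  have hc' : (1 : ℝ) ≤ u.count a := by exact_mod_cast hc
  have hl : (1 : ℝ) ≤ u.length := by exact_mod_cast hc.trans List.count_le_length
  apply Real.logb_le_logb_of_le (by norm_num) (by positivity)
  refine (div_le_self (by positivity) hc').trans ?_
  exact_mod_cast hn

theorem length_mul_H0_eq_zero {σ : ℕ} (u : List (Fin σ)) (hu : ∀ a ∈ u, ∀ b ∈ u, a = b) :
    (u.length : ℝ) * H0 u = 0 := by
  rw [length_mul_H0]
  refine Finset.sum_eq_zero fun a ha => ?_
  rw [List.mem_toFinset] at ha
  have h1 : u.count a = u.length := List.count_eq_length.2 fun b hb => hu a ha b hb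
  have h2 : (u.length : ℝ) ≠ 0 := by
    have := List.length_pos_of_mem ha
    positivity
  rw [h1, div_self h2, Real.logb_one, mul_zero]

/-- Indexing occurrences by their starting positions lets entropy be charged to a set of positions.
-/
theorem followers_eq {σ : ℕ} (w s : List (Fin σ)) :
    followers w s = ((List.range (s.length + 1)).filter fun p => w.isPrefixOf (s.drop p)).flatMap
      fun p => (s.drop (p + w.length)).take 1 := by
  have h : s.tails = (List.range (s.length + 1)).map s.drop := by
    apply List.ext_getElem
    · simp
    · intro i h1 h2
      simp [List.getElem_tails]
  rw [followers, h, List.filter_map, List.flatMap_map]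
  simp [Function.comp_def]

theorem mem_followers {σ : ℕ} {w s : List (Fin σ)} {a : Fin σ} :
    a ∈ followers w s ↔ ∃ p, w <+: s.drop p ∧ s[p + w.length]? = some a := by
  rw [followers_eq]
  simp only [List.mem_flatMap, List.mem_filter, List.mem_range, List.isPrefixOf_iff_prefix,
    List.take_one, List.head?_drop, Option.mem_toList]
  constructor
  · rintro ⟨p, ⟨_, h⟩, h2⟩
    exact ⟨p, h, h2⟩
  · rintro ⟨p, h, h2⟩
    refine ⟨p, ⟨?_, h⟩, h2⟩
    have := (List.getElem?_eq_some_iff.1 h2).1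
    omega

open Classical in
theorem length_followers {σ : ℕ} (w s : List (Fin σ)) :
    (followers w s).length =
      ((Finset.range s.length).filter fun p => w <+: s.drop p ∧ p + w.length < s.length).card := by
  have hnd : ((List.range (s.length + 1)).filter fun p => w.isPrefixOf (s.drop p)).Nodup :=
    List.Nodup.filter _ List.nodup_range
  have hlen : ∀ p, ((s.drop (p + w.length)).take 1).length =
      if p + w.length < s.length then 1 else 0 := by
    intro p
    rw [List.length_take, List.length_drop]
    split_ifs <;> omega
  rw [followers_eq, List.length_flatMap, ← List.sum_toFinset _ hnd]
  simp only [hlen]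
  rw [← Finset.card_filter]
  congr 1
  ext p
  simp only [Finset.mem_filter, List.mem_toFinset, List.mem_filter, List.mem_range,
    List.isPrefixOf_iff_prefix, Finset.mem_range]
  constructor
  · rintro ⟨⟨_, h⟩, h2⟩
    exact ⟨by omega, h, h2⟩
  · rintro ⟨_, h, h2⟩
    exact ⟨⟨by omega, h⟩, h2⟩

/-- Only the positions at which the context does not determine the next character contribute to
the `k`th-order empirical entropy. -/
theorem length_mul_Hk_le {σ : ℕ} (k : ℕ) (s : List (Fin σ)) (B : Finset ℕ)
    (hB : ∀ (w : List (Fin σ)) (p q : ℕ), w.length = k → w <+: s.drop p → w <+: s.drop q →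
      p + k < s.length → q + k < s.length → s[p + k]? ≠ s[q + k]? → p ∈ B) :
    (s.length : ℝ) * Hk k s ≤ B.card * Real.logb 2 s.length := by
  classical
  rcases s.eq_nil_or_concat with rfl | ⟨s', x, hs'⟩
  · simp
  have hpos : 0 < s.length := by simp [hs']
  have hpos' : (s.length : ℝ) ≠ 0 := by positivity
  have hlog : 0 ≤ Real.logb 2 s.length :=
    Real.logb_nonneg (by norm_num) (by exact_mod_cast hpos)
  rw [Hk, ← mul_assoc, mul_one_div_cancel hpos', one_mul]
  have hterm : ∀ w : Fin k → Fin σ,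
      ((followers (List.ofFn w) s).length : ℝ) * H0 (followers (List.ofFn w) s) ≤
        (B.filter fun p => List.ofFn w <+: s.drop p).card * Real.logb 2 s.length := by
    intro w
    by_cases hconst : ∀ a ∈ followers (List.ofFn w) s, ∀ b ∈ followers (List.ofFn w) s, a = b
    · rw [length_mul_H0_eq_zero _ hconst]
      positivity
    · push Not at hconst
      obtain ⟨a, ha, b, hb, hab⟩ := hconst
      have hle : (followers (List.ofFn w) s).length ≤ s.length := by
        rw [length_followers]
        exact (Finset.card_filter_le _ _).trans (Finset.card_range _).le
      refine (length_mul_H0_le _ hle).trans (mul_le_mul_of_nonneg_right ?_ hlog)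
      rw [Nat.cast_le, length_followers]
      apply Finset.card_le_card
      intro p hp
      simp only [Finset.mem_filter, List.length_ofFn] at hp ⊢
      refine ⟨?_, hp.2.1⟩
      obtain ⟨pa, hpa, hpa'⟩ := mem_followers.1 ha
      obtain ⟨pb, hpb, hpb'⟩ := mem_followers.1 hb
      rw [List.length_ofFn] at hpa' hpb'
      have la := (List.getElem?_eq_some_iff.1 hpa').1
      have lb := (List.getElem?_eq_some_iff.1 hpb').1
      -- Since a ≠ b, the character following the occurrence at p differs from at least one of them.
      by_cases hpe : s[p + k]? = some a
      · refine hB _ p pb List.length_ofFn hp.2.1 hpb hp.2.2 lb ?_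
        rw [hpe, hpb']
        simpa using hab
      · refine hB _ p pa List.length_ofFn hp.2.1 hpa hp.2.2 la ?_
        rwa [hpa']
  refine (Finset.sum_le_sum fun w _ => hterm w).trans ?_
  rw [← Finset.sum_mul]
  refine mul_le_mul_of_nonneg_right ?_ hlog
  rw [← Nat.cast_sum, Nat.cast_le, ← Finset.card_biUnion]
  · exact Finset.card_le_card (Finset.biUnion_subset.2 fun w _ => Finset.filter_subset _ _)
  · intro w _ w' _ hne
    -- A position determines the context of length k starting there, so no position is charged
    -- twice.
    refine Finset.disjoint_left.2 fun p hp hp' => hne ?_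
    have h1 := (Finset.mem_filter.1 hp).2
    have h2 := (Finset.mem_filter.1 hp').2
    apply List.ofFn_injective
    exact (List.prefix_of_prefix_length_le h1 h2 (by simp)).eq_of_length (by simp)

/-! ### Periodic strings -/

/-- The string of length `n` that repeats the cyclic word `t`. -/
def periodicString {σ r : ℕ} (t : ZMod r → Fin σ) (n : ℕ) : List (Fin σ) :=
  List.ofFn fun p : Fin n => t ((p : ℕ) : ZMod r)

@[simp]
theorem length_periodicString {σ r : ℕ} (t : ZMod r → Fin σ) (n : ℕ) :
    (periodicString t n).length = n := by
  simp [periodicString]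

theorem getElem?_periodicString {σ r : ℕ} (t : ZMod r → Fin σ) {n p : ℕ} (hp : p < n) :
    (periodicString t n)[p]? = some (t (p : ZMod r)) := by
  simp [periodicString, hp]

/-- In a periodic string, contexts are ambiguous only at the repeated positions of the cyclic
word. -/
theorem length_mul_Hk_periodicString_le {σ r : ℕ} [NeZero r] (k : ℕ) (t : ZMod r → Fin σ)
    (n : ℕ) :
    (n : ℝ) * Hk k (periodicString t n) ≤
      ((repeatedPositions k t).card * (n / r + 1) : ℕ) * Real.logb 2 n := by
  classical
  rcases Nat.eq_zero_or_pos n with rfl | hn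
  · simp
  have hlog : 0 ≤ Real.logb 2 n := Real.logb_nonneg (by norm_num) (by exact_mod_cast hn)
  set B := (Finset.range n).filter fun p : ℕ => (p : ZMod r) ∈ repeatedPositions k t with hBdef
  have hmain := length_mul_Hk_le k (periodicString t n) B (by
    intro w p q hw hp hq hpn hqn hne
    rw [length_periodicString] at hpn hqn
    rw [getElem?_periodicString t hpn, getElem?_periodicString t hqn] at hne
    rw [hBdef, Finset.mem_filter, Finset.mem_range, mem_repeatedPositions]
    refine ⟨by omega, (q : ZMod r), ?_, ?_⟩
    · intro h
      apply hne
      rw [Nat.cast_add, Nat.cast_add, h]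
    · intro l hl
      have aux : ∀ x, w <+: (periodicString t n).drop x → x + k < n →
          w[l]? = some (t ((x : ZMod r) + (l : ℕ))) := by
        intro x hx hxn
        rw [← Nat.cast_add, ← getElem?_periodicString t (show x + l < n by omega),
          ← List.getElem?_drop]
        obtain ⟨v, hv⟩ := hx
        rw [← hv, List.getElem?_append_left (by omega)]
      exact Option.some_injective _ ((aux p hp hpn).symm.trans (aux q hq hqn)))
  rw [length_periodicString] at hmain
  refine hmain.trans (mul_le_mul_of_nonneg_right ?_ hlog)
  rw [Nat.cast_le]
  have hr : 0 < r := NeZero.pos r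
  calc B.card ≤ ((repeatedPositions k t) ×ˢ Finset.range (n / r + 1)).card := by
        apply Finset.card_le_card_of_injOn (fun p : ℕ => ((p : ZMod r), p / r))
        · intro p hp
          have hp' := Finset.mem_filter.1 (Finset.mem_coe.1 hp)
          simp only [Finset.coe_product, Set.mem_prod, Finset.mem_coe, Finset.mem_range]
          exact ⟨hp'.2, Nat.lt_succ_of_le (Nat.div_le_div_right (Finset.mem_range.1 hp'.1).le)⟩
        · intro p _ q _ h
          obtain ⟨h1, h2⟩ := Prod.ext_iff.1 h
          have h1' := (ZMod.natCast_eq_natCast_iff' p q r).1 h1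
          simp only at h2
          rw [← Nat.div_add_mod p r, ← Nat.div_add_mod q r, h1', h2]
    _ = _ := by rw [Finset.card_product, Finset.card_range]

/-! ### Tracing a part of the output of a transducer back to its input -/

/-- The state and the output of a transducer after reading a list of symbols. -/
def transduce {Q X Y : Type} (f : Q → X → Q × List Y) : Q → List X → Q × List Y
  | q, [] => (q, [])
  | q, x :: xs => ((transduce f (f q x).1 xs).1, (f q x).2 ++ (transduce f (f q x).1 xs).2)

theorem transduce_append {Q X Y : Type} (f : Q → X → Q × List Y) (q : Q) (u v : List X) :
    transduce f q (u ++ v) = ((transduce f (transduce f q u).1 v).1,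
      (transduce f q u).2 ++ (transduce f (transduce f q u).1 v).2) := by
  induction u generalizing q with
  | nil => simp [transduce]
  | cons x u ih => simp [transduce, ih]

/-- The entries of `z` at the positions from `a` to `b`, both included. -/
def listSegment {X : Type} (z : List X) (a b : ℕ) : List X :=
  (z.drop a).take (b + 1 - a)

theorem length_listSegment_le {X : Type} (z : List X) (a b : ℕ) :
    (listSegment z a b).length ≤ b + 1 - a := by
  simp [listSegment]

theorem take_append_listSegment {X : Type} (z : List X) {a b : ℕ} (hab : a ≤ b) :
    z.take a ++ listSegment z a b = z.take (b + 1) := by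
  rw [listSegment, ← List.take_add]
  congr 1
  omega

/-- Every part of the output of a transducer is obtained, by cutting, from its output on the part
of the input that is read meanwhile; the positions in the input depend monotonically on those in
the output. -/
theorem exists_source {Q X Y : Type} (f : Q → X → Q × List Y) (q : Q) (z : List X) :
    ∃ F : ℕ → ℕ, (∀ b < (transduce f q z).2.length, F b < z.length) ∧
      (∀ a b, a ≤ b → b < (transduce f q z).2.length → F a ≤ F b) ∧
      ∀ a b, a ≤ b → b < (transduce f q z).2.length → ∃ o ≤ a,
        listSegment (transduce f q z).2 a b =
          ((transduce f (transduce f q (z.take (F a))).1 (listSegment z (F a) (F b))).2.drop o).take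
            (b + 1 - a) := by
  set y := (transduce f q z).2 with hy
  set g : ℕ → ℕ := fun i => (transduce f q (z.take i)).2.length with hg
  have hg0 : g 0 = 0 := by simp [hg, transduce]
  have hgz : g z.length = y.length := by simp [hg, hy]
  have hex : ∀ b < y.length, ∃ i < z.length, b < g (i + 1) := by
    intro b hb
    have hz : z.length ≠ 0 := by
      intro h
      rw [h, hg0] at hgz
      omega
    refine ⟨z.length - 1, by omega, ?_⟩
    rwa [Nat.sub_add_cancel (by omega), hgz]
  -- `F b` is the input symbol during whose reading the output symbol b is written.
  set F : ℕ → ℕ := fun b => sInf {i | b < g (i + 1)} with hF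
  have hFspec : ∀ b < y.length, b < g (F b + 1) := fun b hb =>
    Nat.sInf_mem (s := {i | b < g (i + 1)}) (by obtain ⟨i, _, hi⟩ := hex b hb; exact ⟨i, hi⟩)
  have hFmin : ∀ b i, b < g (i + 1) → F b ≤ i := fun b i h => Nat.sInf_le h
  have hFle : ∀ b, g (F b) ≤ b := by
    intro b
    rcases Nat.eq_zero_or_pos (F b) with h | h
    · rw [h, hg0]
      exact Nat.zero_le _
    · by_contra hcon
      have := hFmin b (F b - 1) (by rw [Nat.sub_add_cancel h]; omega)
      omega
  have hmono : ∀ a b, a ≤ b → b < y.length → F a ≤ F b := fun a b hab hb =>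
    hFmin a _ (lt_of_le_of_lt hab (hFspec b hb))
  refine ⟨F, ?_, hmono, ?_⟩
  · intro b hb
    obtain ⟨i, hi, hbi⟩ := hex b hb
    exact lt_of_le_of_lt (hFmin b i hbi) hi
  · intro a b hab hb
    -- Restarting just before symbol `F a` yields the output from position `g (F a)` on, which may
    -- be earlier than a.
    refine ⟨a - g (F a), Nat.sub_le _ _, ?_⟩
    have h1 : (transduce f q (z.take (F b + 1))).2 = (transduce f q (z.take (F a))).2 ++
        (transduce f (transduce f q (z.take (F a))).1 (listSegment z (F a) (F b))).2 := by
      rw [← take_append_listSegment z (hmono a b hab hb), transduce_append]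
    have h2 : y = (transduce f q (z.take (F b + 1))).2 ++
        (transduce f (transduce f q (z.take (F b + 1))).1 (z.drop (F b + 1))).2 := by
      rw [hy]
      conv_lhs => rw [← List.take_append_drop (F b + 1) z]
      rw [transduce_append]
    have h3 := hFspec b hb
    have h4 := hFle a
    simp only [hg] at h3 h4 ⊢
    rw [listSegment, h2, List.drop_append_of_le_length (by omega),
      List.take_append_of_le_length (by rw [List.length_drop]; omega), h1, List.drop_append,
      List.drop_of_length_le h4, List.nil_append]

/-- Apply a transducer repeatedly, each time from a given state, and each time keep only a part,
given by its position and its length, of the output. -/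
def replay {Q X : Type} (f : Q → X → Q × List X) (u : List X) (ds : List (Q × ℕ × ℕ)) : List X :=
  ds.foldl (fun u d => ((transduce f d.1 u).2.drop d.2.1).take d.2.2) u

/-- If a monotone map takes `m` disjoint blocks into an interval, then it takes one of them into a
short interval. -/
theorem exists_short_block {F : ℕ → ℕ} {m r L E n : ℕ} (hr : 0 < r) (hm : 0 < m)
    (hn : m * r ≤ n) (hFE : ∀ b < n, F b ≤ E) (hmono : ∀ a b, a ≤ b → b < n → F a ≤ F b)
    (hE : E < m * (L + 1)) :
    ∃ j < m, F (j * r + (r - 1)) ≤ F (j * r) + L := by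
  by_contra! hcon
  -- Source intervals of consecutive blocks may share an endpoint but overlap no further; each long
  -- one advances F by at least L + 1.
  have key : ∀ j < m, (j + 1) * (L + 1) ≤ F (j * r + (r - 1)) := by
    intro j
    induction j with
    | zero =>
      intro hj
      have := hcon 0 hj
      omega
    | succ j ih =>
      intro hj
      have h1 := ih (by omega)
      have h2 := hcon (j + 1) hj
      have h3 : (j + 1 + 1) * r ≤ m * r := Nat.mul_le_mul_right _ hj
      have h4 : (j + 1 + 1) * r = (j + 1) * r + r := by ring
      have h5 : (j + 1) * r = j * r + r := by ring
      have h6 := hmono (j * r + (r - 1)) ((j + 1) * r) (by omega) (by omega)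
      have h7 : (j + 1 + 1) * (L + 1) = (j + 1) * (L + 1) + (L + 1) := by ring
      omega
  obtain ⟨m, rfl⟩ := Nat.exists_eq_add_of_lt hm
  have h1 := key m (by omega)
  have h2 := hFE (m * r + (r - 1)) (by
    have : (0 + m + 1) * r = m * r + r := by ring
    omega)
  have h3 : (0 + m + 1) * (L + 1) = (m + 1) * (L + 1) := by ring
  omega

/-! ### Lists of bounded length -/

open Classical in
/-- The lists of length at most `L` with entries in `S`. -/
noncomputable def boundedLists {α : Type} (S : Finset α) : ℕ → Finset (List α)
  | 0 => {[]}
  | L + 1 => insert [] ((S ×ˢ boundedLists S L).image fun x => x.1 :: x.2)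

theorem mem_boundedLists {α : Type} {S : Finset α} {L : ℕ} {l : List α} (hl : l.length ≤ L)
    (hS : ∀ x ∈ l, x ∈ S) : l ∈ boundedLists S L := by
  classical
  induction L generalizing l with
  | zero =>
    rw [boundedLists, Finset.mem_singleton]
    exact List.length_eq_zero_iff.1 (Nat.le_zero.1 hl)
  | succ L ih =>
    rw [boundedLists]
    cases l with
    | nil => exact Finset.mem_insert_self _ _
    | cons x l =>
      refine Finset.mem_insert_of_mem (Finset.mem_image.2 ⟨(x, l), ?_, rfl⟩)
      rw [Finset.mem_product]
      exact ⟨hS x (by simp), ih (by simpa using hl) fun y hy => hS y (by simp [hy])⟩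

/-- A shorter list can be padded to length L with one extra symbol, hence the base |S| + 1, which is
3 for memory contents. -/
theorem card_boundedLists_le {α : Type} (S : Finset α) (L : ℕ) :
    (boundedLists S L).card ≤ (S.card + 1) ^ L := by
  classical
  induction L with
  | zero => simp [boundedLists]
  | succ L ih =>
    rw [boundedLists]
    refine (Finset.card_insert_le _ _).trans ?_
    calc _ ≤ S.card * (boundedLists S L).card + 1 := by
          rw [← Finset.card_product]
          exact Nat.add_le_add_right Finset.card_image_le _
      _ ≤ S.card * (S.card + 1) ^ L + (S.card + 1) ^ L :=
          Nat.add_le_add (Nat.mul_le_mul_left _ ih) (Nat.one_le_pow _ _ (by omega))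
      _ = (S.card + 1) ^ (L + 1) := by ring

/-! ### Describing the cyclic word by a stretch of the encoding -/

namespace WStreamsDecoder

variable {σ : ℕ} {Γ : Type}

/-- One pass as a transducer from the old to the new contents of the tape, end marks included. -/
def tapeStep (A : WStreamsDecoder σ Γ) (q : List Bool) (x : Option Γ) :
    List Bool × List (Option Γ) :=
  ((A.step q x).1, (A.step q x).2.1.map some ++ (if x.isNone then [none] else []))

/-- One pass as a transducer from the contents of the tape to the output. -/
def outputStep (A : WStreamsDecoder σ Γ) (q : List Bool) (x : Option Γ) :
    List Bool × List (Fin σ) :=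
  ((A.step q x).1, (A.step q x).2.2)

open Classical in
/-- The transducer that reads off a string over the alphabet from the tape. -/
noncomputable def charStep (A : WStreamsDecoder σ Γ) (q : List Bool) (x : Option Γ) :
    List Bool × List (Fin σ) :=
  (q, if h : ∃ a, x = some (A.char a) then [h.choose] else [])

theorem transduce_outputStep (A : WStreamsDecoder σ Γ) (q : List Bool) (z : List (Option Γ)) :
    transduce A.outputStep q z = ((A.scan q z).1, (A.scan q z).2.2) := by
  induction z generalizing q with
  | nil => rfl
  | cons x z ih => simp [transduce, ih, scan, outputStep]

theorem transduce_tapeStep_fst (A : WStreamsDecoder σ Γ) (q : List Bool)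
    (z : List (Option Γ)) : (transduce A.tapeStep q z).1 = (A.scan q z).1 := by
  induction z generalizing q with
  | nil => rfl
  | cons x z ih => simp [transduce, ih, scan, tapeStep]

/-- Emitting an end mark on reading one makes the output of a pass a marked tape again, so that
passes compose. -/
theorem transduce_tapeStep_snd (A : WStreamsDecoder σ Γ) (q : List Bool) (u : List Γ) :
    (transduce A.tapeStep q (markEnd u)).2 = markEnd (A.scan q (markEnd u)).2.1 := by
  unfold markEnd
  induction u generalizing q with
  | nil => simp [transduce, scan, tapeStep]
  | cons x u ih => simp [transduce, ih, scan, tapeStep]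

theorem transduce_charStep_fst (A : WStreamsDecoder σ Γ) (q : List Bool)
    (z : List (Option Γ)) : (transduce A.charStep q z).1 = q := by
  induction z generalizing q with
  | nil => rfl
  | cons x z ih => simp [transduce, ih, charStep]

/-- Delivery on the tape thus becomes one further, stateless transduction, treated together with
delivery through the output stream. -/
theorem transduce_charStep_snd (A : WStreamsDecoder σ Γ) (q : List Bool) (s : List (Fin σ)) :
    (transduce A.charStep q (markEnd (s.map A.char))).2 = s := by
  unfold markEnd
  induction s generalizing q with
  | nil => simp [transduce, charStep]
  | cons x s ih =>
    simp only [List.map_cons, List.cons_append, transduce, charStep] at ih ⊢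
    rw [ih]
    simp

/-- Every part of the contents of the tape after `i` passes is obtained by replaying the passes on
a part of the encoding. -/
theorem exists_tape_source (A : WStreamsDecoder σ Γ) (e : List Bool) {M N : ℕ} (i : ℕ)
    (hmem : ∀ j < i, ∀ l, l <+: markEnd (A.afterPasses e j).2.1 →
      (A.scan (A.afterPasses e j).1 l).1.length ≤ M)
    (htape : ∀ j ≤ i, (markEnd (A.afterPasses e j).2.1).length ≤ N) :
    ∃ F : ℕ → ℕ, (∀ b < (markEnd (A.afterPasses e i).2.1).length, F b ≤ e.length) ∧
      (∀ a b, a ≤ b → b < (markEnd (A.afterPasses e i).2.1).length → F a ≤ F b) ∧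
      ∀ a b, a ≤ b → b < (markEnd (A.afterPasses e i).2.1).length →
        ∃ ds : List (List Bool × ℕ × ℕ), ds.length = i ∧
          (∀ d ∈ ds, d.1.length ≤ M ∧ d.2.1 ≤ N ∧ d.2.2 ≤ N) ∧
          replay A.tapeStep (listSegment (markEnd (e.map A.bit)) (F a) (F b)) ds =
            listSegment (markEnd (A.afterPasses e i).2.1) a b := by
  induction i with
  | zero =>
    refine ⟨id, ?_, fun _ _ h _ => h, fun a b _ _ => ⟨[], rfl, by simp, rfl⟩⟩
    intro b hb
    simp only [afterPasses, markEnd, List.length_append, List.length_map, List.length_singleton]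
      at hb
    exact Nat.lt_succ_iff.1 hb
  | succ i ih =>
    obtain ⟨F, hFe, hFm, hF⟩ := ih (fun j hj => hmem j (by omega)) (fun j hj => htape j (by omega))
    obtain ⟨F', hFe', hFm', hF'⟩ := exists_source A.tapeStep (A.afterPasses e i).1
      (markEnd (A.afterPasses e i).2.1)
    have hN := htape (i + 1) le_rfl
    have heq : (transduce A.tapeStep (A.afterPasses e i).1
        (markEnd (A.afterPasses e i).2.1)).2 = markEnd (A.afterPasses e (i + 1)).2.1 := by
      rw [transduce_tapeStep_snd]
      rfl
    rw [heq] at hFe' hFm' hF'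
    refine ⟨fun b => F (F' b), fun b hb => hFe _ (hFe' b hb),
      fun a b hab hb => hFm _ _ (hFm' a b hab hb) (hFe' b hb), fun a b hab hb => ?_⟩
    obtain ⟨ds, hlen, hds, hrep⟩ := hF _ _ (hFm' a b hab hb) (hFe' b hb)
    obtain ⟨o, ho, hseg⟩ := hF' a b hab hb
    -- The new pass contributes the memory content when the head reaches the source of a, the offset
    -- of the cut and its length.
    refine ⟨ds ++ [((transduce A.tapeStep (A.afterPasses e i).1
      ((markEnd (A.afterPasses e i).2.1).take (F' a))).1, o, b + 1 - a)], by simp [hlen], ?_, ?_⟩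
    · intro d hd
      rw [List.mem_append, List.mem_singleton] at hd
      rcases hd with hd | rfl
      · exact hds d hd
      · refine ⟨?_, by dsimp only; omega, by dsimp only; omega⟩
        rw [transduce_tapeStep_fst]
        exact hmem i (by omega) _ (List.take_prefix _ _)
    · rw [hseg, ← hrep, replay, List.foldl_append]
      rfl

/-- The cyclic word described by a way of delivery, the memory contents and the cuts in a sequence
of passes, a part of the encoding, the memory contents and the cut in the last pass, and a
rotation. -/
noncomputable def decodeWord (A : WStreamsDecoder σ Γ) (a₀ : Fin σ) (r : ℕ)
    (x : Bool × List (List Bool × ℕ × ℕ) × List (Option Γ) × (List Bool × ℕ) × ZMod r) :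
    ZMod r → Fin σ :=
  fun i => (((transduce (if x.1 then A.outputStep else A.charStep) x.2.2.2.1.1
    (replay A.tapeStep x.2.2.1 x.2.1)).2.drop x.2.2.2.1.2).take r)[(i - x.2.2.2.2).val]?.getD a₀

open Classical in
/-- The descriptions of bounded size. -/
noncomputable def codes (Γ : Type) [Fintype Γ] (M N P L n r : ℕ) [NeZero r] :
    Finset (Bool × List (List Bool × ℕ × ℕ) × List (Option Γ) × (List Bool × ℕ) × ZMod r) :=
  Finset.univ ×ˢ
    boundedLists (boundedLists Finset.univ M ×ˢ Finset.range (N + 1) ×ˢ Finset.range (N + 1)) P ×ˢ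
    boundedLists Finset.univ (L + 1) ×ˢ
    (boundedLists Finset.univ M ×ˢ Finset.range (n + 1)) ×ˢ Finset.univ

theorem card_codes_le (Γ : Type) [Fintype Γ] (M N P L n r : ℕ) [NeZero r] :
    (codes Γ M N P L n r).card ≤ 2 * ((3 ^ M * ((N + 1) * (N + 1)) + 1) ^ P *
      ((Fintype.card Γ + 2) ^ (L + 1) * (3 ^ M * (n + 1) * r))) := by
  have hM : (boundedLists (Finset.univ : Finset Bool) M).card ≤ 3 ^ M := by
    simpa using card_boundedLists_le (Finset.univ : Finset Bool) M
  have hΓ : (boundedLists (Finset.univ : Finset (Option Γ)) (L + 1)).card ≤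
      (Fintype.card Γ + 2) ^ (L + 1) := by
    simpa [Fintype.card_option, add_assoc] using
      card_boundedLists_le (Finset.univ : Finset (Option Γ)) (L + 1)
  simp only [codes, Finset.card_product, Finset.card_range, Finset.card_univ, Fintype.card_bool,
    ZMod.card]
  gcongr
  refine (card_boundedLists_le _ _).trans ?_
  simp only [Finset.card_product, Finset.card_range]
  gcongr

/-- A part of the periodic string that is delivered in one pass contains a rotation of the cyclic
word that depends on few symbols of the encoding only. -/
theorem exists_code_of_pass (A : WStreamsDecoder σ Γ) [Fintype Γ] (a₀ : Fin σ) {e : List Bool}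
    {M N P L n m r : ℕ} [NeZero r] {t : ZMod r → Fin σ} {i : ℕ} (hi : i ≤ P) (hm : 0 < m)
    (hmem : ∀ j < i, ∀ l, l <+: markEnd (A.afterPasses e j).2.1 →
      (A.scan (A.afterPasses e j).1 l).1.length ≤ M)
    (htape : ∀ j ≤ i, (markEnd (A.afterPasses e j).2.1).length ≤ N)
    (he : e.length < m * (L + 1)) (v : Bool) (q : List Bool)
    (hq : ∀ l, l <+: markEnd (A.afterPasses e i).2.1 →
      (transduce (if v then A.outputStep else A.charStep) q l).1.length ≤ M)
    (d : ℕ) (hd : ∀ j < m * r, (transduce (if v then A.outputStep else A.charStep) q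
      (markEnd (A.afterPasses e i).2.1)).2[j]? = some (t ((d + j : ℕ) : ZMod r)))
    (hn : (transduce (if v then A.outputStep else A.charStep) q
      (markEnd (A.afterPasses e i).2.1)).2.length ≤ n) :
    ∃ x ∈ codes Γ M N P L n r, A.decodeWord a₀ r x = t := by
  have hr : 0 < r := NeZero.pos r
  obtain ⟨F, hFe, hFm, hF⟩ := A.exists_tape_source e i hmem htape
  obtain ⟨F', hFe', hFm', hF'⟩ := exists_source (if v then A.outputStep else A.charStep) q
    (markEnd (A.afterPasses e i).2.1)
  set y := (transduce (if v then A.outputStep else A.charStep) q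
      (markEnd (A.afterPasses e i).2.1)).2 with hy
  have hylen : m * r ≤ y.length := by
    have h1 : 0 < m * r := Nat.mul_pos hm hr
    have := (List.getElem?_eq_some_iff.1 (hd (m * r - 1) (by omega))).1
    omega
  obtain ⟨j, hj, hshort⟩ := exists_short_block (F := fun b => F (F' b)) hr hm hylen
    (fun b hb => hFe _ (hFe' b hb)) (fun a b hab hb => hFm _ _ (hFm' a b hab hb) (hFe' b hb)) he
  have hjr : j * r + r ≤ m * r := by
    calc j * r + r = (j + 1) * r := by ring
      _ ≤ m * r := Nat.mul_le_mul_right _ hj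
  have hab : j * r ≤ j * r + (r - 1) := Nat.le_add_right _ _
  have hb : j * r + (r - 1) < y.length := by omega
  obtain ⟨ds, hlen, hds, hrep⟩ := hF _ _ (hFm' _ _ hab hb) (hFe' _ hb)
  obtain ⟨o, ho, hseg⟩ := hF' _ _ hab hb
  set q' := (transduce (if v then A.outputStep else A.charStep) q
    ((markEnd (A.afterPasses e i).2.1).take (F' (j * r)))).1 with hq'
  -- The block starts at position d + jr of the periodic string, so it spells t rotated by that
  -- amount. Both endpoints of the source belong to it, which accounts for L + 1 symbols.
  refine ⟨(v, ds, listSegment (markEnd (e.map A.bit)) (F (F' (j * r))) (F (F' (j * r + (r - 1)))),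
    (q', o), ((d + j * r : ℕ) : ZMod r)), ?_, ?_⟩
  · simp only [codes, Finset.mem_product, Finset.mem_univ, true_and, and_true, Finset.mem_range]
    refine ⟨mem_boundedLists (by omega) fun x hx => ?_,
      mem_boundedLists ((length_listSegment_le _ _ _).trans (by omega)) (by simp),
      mem_boundedLists (hq _ (List.take_prefix _ _)) (by simp), by omega⟩
    obtain ⟨h1, h2, h3⟩ := hds x hx
    simp only [Finset.mem_product, Finset.mem_range]
    exact ⟨mem_boundedLists h1 (by simp), by omega, by omega⟩
  · funext x
    have hlen2 : j * r + (r - 1) + 1 - j * r = r := by omega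
    rw [hlen2] at hseg
    simp only [decodeWord]
    rw [hrep, ← hseg, listSegment, hlen2]
    have hval := ZMod.val_lt (x - ((d + j * r : ℕ) : ZMod r))
    rw [List.getElem?_take_of_lt hval, List.getElem?_drop, hd _ (by omega), Option.getD_some]
    congr 1
    rw [Nat.cast_add, Nat.cast_add, ZMod.natCast_zmod_val, Nat.cast_add]
    ring

/-- If a periodic string is recovered from a short encoding, then its cyclic word has a short
description. -/
theorem exists_code (A : WStreamsDecoder σ Γ) [Fintype Γ] (a₀ : Fin σ) {e : List Bool}
    {M N P L n m r p : ℕ} [NeZero r] {t : ZMod r → Fin σ} (hp : p ≤ P) (hm : 0 < m)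
    (hmem : ∀ j < p, ∀ l, l <+: markEnd (A.afterPasses e j).2.1 →
      (A.scan (A.afterPasses e j).1 l).1.length ≤ M)
    (htape : ∀ j ≤ p, (markEnd (A.afterPasses e j).2.1).length ≤ N)
    (he : e.length < m * (L + 1)) (hn : m * r * (P + 1) ≤ n)
    (hrec : (A.afterPasses e p).2.1 = (periodicString t n).map A.char ∨
      (A.afterPasses e p).2.2 = periodicString t n) :
    ∃ x ∈ codes Γ M N P L n r, A.decodeWord a₀ r x = t := by
  have hmr : 0 < m * r := Nat.mul_pos hm (NeZero.pos r)
  have hmrn : m * r ≤ n := le_trans (Nat.le_mul_of_pos_right _ (by omega)) hn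
  rcases hrec with hrec | hrec
  · refine A.exists_code_of_pass a₀ hp hm hmem htape he false [] ?_ 0 ?_ ?_
    · intro l _
      simp [transduce_charStep_fst]
    · intro j hj
      simp only [Bool.false_eq_true, if_false]
      rw [hrec, transduce_charStep_snd, getElem?_periodicString t (by omega), Nat.zero_add]
    · simp only [Bool.false_eq_true, if_false]
      rw [hrec, transduce_charStep_snd, length_periodicString]
  · have hsucc : ∀ i, (A.afterPasses e (i + 1)).2.2 = (A.afterPasses e i).2.2 ++
        (transduce A.outputStep (A.afterPasses e i).1 (markEnd (A.afterPasses e i).2.1)).2 := by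
      intro i
      rw [transduce_outputStep]
      rfl
    have hprefix : ∀ i j, i ≤ j → (A.afterPasses e i).2.2 <+: (A.afterPasses e j).2.2 := by
      intro i j hij
      induction j, hij using Nat.le_induction with
      | base => exact List.prefix_rfl
      | succ j _ ih =>
        rw [hsucc]
        exact ih.trans (List.prefix_append _ _)
    -- The output has length n, which exceeds P·m·r, so some single pass writes m whole blocks.
    obtain ⟨i, hip, hlong⟩ : ∃ i < p, m * r ≤
        (transduce A.outputStep (A.afterPasses e i).1 (markEnd (A.afterPasses e i).2.1)).2.length
        := by
      by_contra! hcon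
      have hle : ∀ i ≤ p, (A.afterPasses e i).2.2.length ≤ i * (m * r) := by
        intro i
        induction i with
        | zero => simp [afterPasses]
        | succ i ih =>
          intro hi
          rw [hsucc, List.length_append, Nat.succ_mul]
          exact Nat.add_le_add (ih (by omega)) (hcon i (by omega)).le
      have h1 := hle p le_rfl
      rw [hrec, length_periodicString] at h1
      have h2 : p * (m * r) ≤ P * (m * r) := Nat.mul_le_mul_right _ hp
      have h3 : m * r * (P + 1) = P * (m * r) + m * r := by ring
      omega
    have hpre := hprefix (i + 1) p hip
    rw [hrec, hsucc] at hpre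
    have hprelen := hpre.length_le
    rw [List.length_append, length_periodicString] at hprelen
    refine A.exists_code_of_pass a₀ (hip.le.trans hp) hm (fun j hj => hmem j (hj.trans hip))
      (fun j hj => htape j (hj.trans hip.le)) he true (A.afterPasses e i).1 ?_
      (A.afterPasses e i).2.2.length ?_ ?_
    · intro l hl
      simp only [if_true]
      rw [transduce_outputStep]
      exact hmem i hip l hl
    · intro j hj
      simp only [if_true]
      obtain ⟨w, hw⟩ := hpre
      have hlt : (A.afterPasses e i).2.2.length + j < n := by omega
      rw [← getElem?_periodicString t hlt, ← hw, List.append_assoc,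
        List.getElem?_append_right (Nat.le_add_right _ _), Nat.add_sub_cancel_left,
        List.getElem?_append_left (by omega)]
    · simp only [if_true]
      omega

end WStreamsDecoder

/-! ### Counting descriptions against cyclic words -/

namespace WStreamsDecoder

variable {σ : ℕ} {Γ : Type}

theorem length_markEnd_le (A : WStreamsDecoder σ Γ) {e : List Bool} {G : ℝ} {g p : ℕ}
    (hg : G + 1 ≤ g)
    (hG : ∀ i < p, ((A.afterPasses e (i + 1)).2.1.length : ℝ) ≤
      G * (((A.afterPasses e i).2.1.length : ℝ) + 1)) :
    ∀ i ≤ p, (markEnd (A.afterPasses e i).2.1).length ≤ g ^ i * (e.length + 1) := by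
  intro i
  induction i with
  | zero => simp [afterPasses, markEnd]
  | succ i ih =>
    intro hi
    have h1 := ih (by omega)
    have h2 := hG i (by omega)
    simp only [markEnd, List.length_append, List.length_map, List.length_singleton] at h1 ⊢
    -- The extra 1 in g ≥ G + 1 pays for the end mark.
    have h3 : (A.afterPasses e (i + 1)).2.1.length + 1 ≤
        g * ((A.afterPasses e i).2.1.length + 1) := by
      have h0 : (0 : ℝ) ≤ (A.afterPasses e i).2.1.length := Nat.cast_nonneg _
      have : ((A.afterPasses e (i + 1)).2.1.length : ℝ) + 1 ≤
        g * (((A.afterPasses e i).2.1.length : ℝ) + 1) := by nlinarith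
      exact_mod_cast this
    calc _ ≤ _ := h3
      _ ≤ g * (g ^ i * (e.length + 1)) := Nat.mul_le_mul_left _ h1
      _ = g ^ (i + 1) * (e.length + 1) := by ring

/-- The exponent in `hexp` is a bit budget. Each pass costs 2M bits for the memory, as 3^M ≤ 4^M,
and gP + l + 1 for each of two cuts, plus one for shorter lists. Each symbol of the stretch costs K;
the last pass costs 2M + l and the rotation l. The leading 2 covers the way of delivery and the
factor 2 on the left. -/
theorem two_mul_card_codes_lt (Γ : Type) [Fintype Γ] (hσ : 2 ≤ σ) {M P L n r E g l K : ℕ}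
    [NeZero r] (hg : 1 ≤ g) (hl : n + 1 ≤ 2 ^ l) (hr : r ≤ n) (hE : E ≤ n)
    (hK : Fintype.card Γ + 2 ≤ 2 ^ K)
    (hexp : 2 + P * (2 * M + 2 * (g * P) + 2 * l + 3) + K * (L + 1) + 2 * M + 2 * l < r) :
    2 * (codes Γ M (g ^ P * (E + 1)) P L n r).card < σ ^ r := by
  have h3 : 3 ^ M ≤ 2 ^ (2 * M) := by
    rw [pow_mul]
    exact Nat.pow_le_pow_left (by norm_num) _
  have hN : g ^ P * (E + 1) + 1 ≤ 2 ^ (g * P + l + 1) := by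
    have h1 : g ^ P ≤ 2 ^ (g * P) := by
      rw [pow_mul]
      exact Nat.pow_le_pow_left Nat.lt_two_pow_self.le _
    have h2 : 1 ≤ g ^ P * (E + 1) := Nat.mul_pos (Nat.pow_pos hg) (by omega)
    calc g ^ P * (E + 1) + 1 ≤ 2 * (g ^ P * (E + 1)) := by omega
      _ ≤ 2 * (2 ^ (g * P) * 2 ^ l) := by gcongr; omega
      _ = 2 ^ (g * P + l + 1) := by ring
  have htriple : 3 ^ M * ((g ^ P * (E + 1) + 1) * (g ^ P * (E + 1) + 1)) + 1 ≤
      2 ^ (2 * M + 2 * (g * P) + 2 * l + 3) := by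
    calc _ ≤ 2 ^ (2 * M) * (2 ^ (g * P + l + 1) * 2 ^ (g * P + l + 1)) + 1 := by gcongr
      _ = 2 ^ (2 * M + 2 * (g * P) + 2 * l + 2) + 1 := by ring
      _ ≤ 2 ^ (2 * M + 2 * (g * P) + 2 * l + 2) + 2 ^ (2 * M + 2 * (g * P) + 2 * l + 2) := by
        gcongr
        exact Nat.one_le_two_pow
      _ = _ := by ring
  calc 2 * (codes Γ M (g ^ P * (E + 1)) P L n r).card
      ≤ 2 * (2 * ((2 ^ (2 * M + 2 * (g * P) + 2 * l + 3)) ^ P *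
        ((2 ^ K) ^ (L + 1) * (2 ^ (2 * M) * 2 ^ l * 2 ^ l)))) := by
        refine Nat.mul_le_mul_left _ ((card_codes_le _ _ _ _ _ _ _).trans ?_)
        gcongr
        exact hr.trans (by omega)
    _ = 2 ^ (2 + P * (2 * M + 2 * (g * P) + 2 * l + 3) + K * (L + 1) + 2 * M + 2 * l) := by
        simp only [← pow_mul, ← pow_add, ← pow_succ']
        congr 1
        ring
    _ < 2 ^ r := Nat.pow_lt_pow_right (by norm_num) hexp
    _ ≤ σ ^ r := Nat.pow_le_pow_left hσ _

/-- Some cyclic word with few repeated positions gives a periodic string that cannot be recovered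
from a short encoding. -/
theorem exists_not_recovers (A : WStreamsDecoder σ Γ) [Fintype Γ] (hσ : 2 ≤ σ) {G Mr Pr : ℝ}
    {k L n m r E g l K : ℕ} [NeZero r] (hk : 2 * k ≤ r) (hG : G + 1 ≤ g) (hg : 1 ≤ g)
    (hl : n + 1 ≤ 2 ^ l) (hr : r ≤ n) (hE : E ≤ n) (hK : Fintype.card Γ + 2 ≤ 2 ^ K)
    (hm : 0 < m) (hmn : m * r * (⌊Pr⌋₊ + 1) ≤ n) (hEm : E < m * (L + 1))
    (hexp : 2 + ⌊Pr⌋₊ * (2 * ⌊Mr⌋₊ + 2 * (g * ⌊Pr⌋₊) + 2 * l + 3) + K * (L + 1) + 2 * ⌊Mr⌋₊ + 2 * l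
      < r) :
    ∃ t : ZMod r → Fin σ, (repeatedPositions k t).card * σ ^ k ≤ 2 * r ^ 2 ∧
      ∀ e : List Bool, e.length ≤ E → ¬ A.Recovers G Mr Pr e (periodicString t n) := by
  classical
  by_contra! hcon
  have hcard := two_mul_card_codes_lt Γ hσ hg hl hr hE hK hexp
  have hmany := card_few_repeatedPositions (σ := σ) hk
  -- Otherwise every word with few repeated positions, hence at least half of all words, would be
  -- decoded from some code.
  refine absurd (hmany.trans (Nat.mul_le_mul_left 2 (?_ : _ ≤
    ((codes Γ ⌊Mr⌋₊ (g ^ ⌊Pr⌋₊ * (E + 1)) ⌊Pr⌋₊ L n r).image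
      (A.decodeWord ⟨0, by omega⟩ r)).card)))
    (not_le.2 (lt_of_le_of_lt (Nat.mul_le_mul_left 2 Finset.card_image_le) hcard))
  apply Finset.card_le_card
  intro t ht
  obtain ⟨e, he, p, hp, hmem, htape, hrec⟩ := hcon t (Finset.mem_filter.1 ht).2
  have hp' : p ≤ ⌊Pr⌋₊ := Nat.le_floor hp
  rw [Finset.mem_image]
  refine A.exists_code _ (e := e) (n := n) (m := m) hp' hm (fun j hj q hq => ?_)
    (fun j hj => ?_) (by omega) hmn hrec
  · exact Nat.le_floor (hmem j hj q hq)
  · refine (A.length_markEnd_le hG htape j hj).trans ?_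
    exact Nat.mul_le_mul (Nat.pow_le_pow_right hg (hj.trans hp')) (by omega)

end WStreamsDecoder

/-! ### Multipass decoders as W-Streams decoders -/

namespace MultipassDecoder

variable {σ : ℕ}

/-- The decoder in the W-Streams model that never changes the tape. -/
def toWStreams (A : MultipassDecoder σ) : WStreamsDecoder σ (Bool ⊕ Fin σ) where
  bit := ⟨Sum.inl, Sum.inl_injective⟩
  char := ⟨Sum.inr, Sum.inr_injective⟩
  start := A.start
  step q x := match x with
    | none => ((A.step q none).1, [], (A.step q none).2)
    | some (Sum.inl b) => ((A.step q (some b)).1, [Sum.inl b], (A.step q (some b)).2)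
    -- Never reached from an encoding, since the tape only ever holds bits.
    | some (Sum.inr _) => (q, [], [])

theorem scan_toWStreams (A : MultipassDecoder σ) (q : List Bool) (l : List (Option Bool)) :
    A.toWStreams.scan q (l.map (Option.map Sum.inl)) =
      ((A.scan q l).1, l.reduceOption.map Sum.inl, (A.scan q l).2) := by
  induction l generalizing q with
  | nil => rfl
  | cons x l ih =>
    rw [List.map_cons, WStreamsDecoder.scan, scan]
    cases x <;> simp [toWStreams] <;> simp [toWStreams] at ih <;> simp [ih]

theorem markEnd_map_inl (e : List Bool) :
    markEnd (e.map (Sum.inl : Bool → Bool ⊕ Fin σ)) = (markEnd e).map (Option.map Sum.inl) := by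
  simp [markEnd, Function.comp_def]

theorem reduceOption_markEnd (e : List Bool) : (markEnd e).reduceOption = e := by
  simp [markEnd, List.reduceOption]

theorem afterPasses_toWStreams (A : MultipassDecoder σ) (e : List Bool) (i : ℕ) :
    A.toWStreams.afterPasses e i =
      ((A.afterPasses e i).1, e.map Sum.inl, (A.afterPasses e i).2) := by
  induction i with
  | zero => rfl
  | succ i ih =>
    simp only [WStreamsDecoder.afterPasses, afterPasses, ih, markEnd_map_inl, scan_toWStreams,
      reduceOption_markEnd]

theorem Recovers.toWStreams {A : MultipassDecoder σ} {M P : ℝ} {e : List Bool}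
    {s : List (Fin σ)} (h : A.Recovers M P e s) : A.toWStreams.Recovers 1 M P e s := by
  obtain ⟨p, hp, hmem, hs⟩ := h
  refine ⟨p, hp, fun i hi l hl => ?_, fun i _ => ?_, Or.inr ?_⟩
  · rw [afterPasses_toWStreams] at hl ⊢
    rw [markEnd_map_inl] at hl
    obtain ⟨l', hl', rfl⟩ := List.prefix_map_iff.1 hl
    rw [scan_toWStreams]
    exact hmem i hi l' hl'
  · rw [afterPasses_toWStreams, afterPasses_toWStreams]
    simp
  · rw [afterPasses_toWStreams]
    exact hs

end MultipassDecoder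

/-! ### Asymptotics and choice of parameters -/

theorem eventually_mul_log_pow_le_rpow (a : ℝ) (b : ℕ) {η : ℝ} (hη : 0 < η) :
    ∀ᶠ n : ℕ in atTop, a * Real.log n ^ b ≤ (n : ℝ) ^ η := by
  have h := ((isLittleO_log_rpow_rpow_atTop (b : ℝ) hη).const_mul_left a).bound one_pos
  filter_upwards [tendsto_natCast_atTop_atTop.eventually h, eventually_ge_atTop 1] with n hn h1
  rw [Real.rpow_natCast, one_mul, Real.norm_eq_abs, Real.norm_eq_abs,
    abs_of_nonneg (Real.rpow_nonneg (Nat.cast_nonneg n) η)] at hn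
  exact (le_abs_self _).trans hn

theorem eventually_const_le_rpow (a : ℝ) {η : ℝ} (hη : 0 < η) :
    ∀ᶠ n : ℕ in atTop, a ≤ (n : ℝ) ^ η := by
  simpa using eventually_mul_log_pow_le_rpow a 0 hη

/-- The choice of the parameters, in terms of `ρ`, a small power of the length `x`, and
`u = x ^ c`. -/
theorem exists_parameters {n k P M g K l : ℕ} {ρ u : ℝ} (hρ : 1000 ≤ ρ) (hu : ρ ^ 64 ≤ u)
    (hx : u * ρ ^ 64 ≤ n) (hk : (k : ℝ) ≤ ρ) (hP : (P : ℝ) ≤ ρ) (hM : (M : ℝ) ≤ ρ * u)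
    (hg : (g : ℝ) ≤ ρ) (hK : (K : ℝ) ≤ ρ) (hl : (l : ℝ) ≤ ρ) :
    ∃ r m L E : ℕ, 0 < r ∧ r ≤ n ∧ (r : ℝ) ≤ u * ρ ^ 16 ∧ 2 * k ≤ r ∧ 0 < m ∧
      m * r * (P + 1) ≤ n ∧ E ≤ n ∧ E < m * (L + 1) ∧
      (∀ x : ℕ, (x : ℝ) ≤ n / ρ ^ 8 → x ≤ E) ∧
      2 + P * (2 * M + 2 * (g * P) + 2 * l + 3) + K * (L + 1) + 2 * M + 2 * l < r := by
  have hρ0 : 0 < ρ := by linarith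
  have hρ1 : 1 ≤ ρ := by linarith
  have hu1 : ρ ≤ u := (le_self_pow₀ hρ1 (by norm_num)).trans hu
  have hu0 : 0 < u := by linarith
  have hbig : ρ ≤ u * ρ ^ 13 / 1000 := by
    have : (1000 : ℝ) ≤ ρ ^ 13 := hρ.trans (le_self_pow₀ hρ1 (by norm_num))
    linarith [mul_le_mul_of_nonneg_left this hu0.le]
  have hn0 : (0 : ℝ) < n := lt_of_lt_of_le (by positivity) hx
  -- The period must exceed the memory used over all passes, of order uρ², and stay well below σ^k ≥
  -- uρ^32.
  set r := ⌊u * ρ ^ 16⌋₊ with hr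
  have hr1 : (r : ℝ) ≤ u * ρ ^ 16 := Nat.floor_le (by positivity)
  have hY : 1000 ≤ u * ρ ^ 16 := by
    calc (1000 : ℝ) ≤ u * 1 := by linarith
      _ ≤ u * ρ ^ 16 := by gcongr; exact one_le_pow₀ hρ1
  have hr2 : u * ρ ^ 16 ≤ 2 * r := by
    have := Nat.lt_floor_add_one (u * ρ ^ 16)
    rw [← hr] at this
    linarith
  have hr0 : 0 < r := by
    have : (0 : ℝ) < r := by linarith
    exact_mod_cast this
  have hr0' : (0 : ℝ) < r := by exact_mod_cast hr0
  have hrP0 : 0 < r * (P + 1) := Nat.mul_pos hr0 (by omega)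
  set m := n / (r * (P + 1)) with hm
  have hP1 : (P : ℝ) + 1 ≤ 2 * ρ := by linarith
  have hrP : (r : ℝ) * (P + 1) ≤ n := by
    calc (r : ℝ) * (P + 1) ≤ u * ρ ^ 16 * (2 * ρ) := by gcongr
      _ ≤ u * ρ ^ 16 * (ρ * ρ) := by gcongr; linarith
      _ = u * ρ ^ 18 := by ring
      _ ≤ u * ρ ^ 64 := by gcongr; norm_num
      _ ≤ n := hx
  have hm0 : 0 < m := Nat.div_pos (by exact_mod_cast hrP) hrP0
  have hm0' : (1 : ℝ) ≤ m := by exact_mod_cast hm0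
  have hm2 : (n : ℝ) < 2 * m * (r * (P + 1)) := by
    have h1 : n < (m + 1) * (r * (P + 1)) := Nat.lt_mul_of_div_lt (Nat.lt_succ_self _) hrP0
    have h2 : (n : ℝ) < (m + 1) * (r * (P + 1)) := by exact_mod_cast h1
    refine h2.trans_le ?_
    gcongr
    linarith
  -- With K ≤ ρ, the stretch of the encoding then costs only about r/ρ bits.
  set L := ⌊r / ρ ^ 2⌋₊ with hL
  have hL1 : (L : ℝ) ≤ r / ρ ^ 2 := Nat.floor_le (by positivity)
  have hL2 : r / ρ ^ 2 < (L : ℝ) + 1 := Nat.lt_floor_add_one _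
  -- The pigeonhole step needs E < m(L + 1), and m(L + 1) exceeds n/(4ρ³).
  set E := ⌊n / ρ ^ 8⌋₊ with hE
  have hE1 : (E : ℝ) ≤ n / ρ ^ 8 := Nat.floor_le (by positivity)
  refine ⟨r, m, L, E, hr0, ?_, hr1, ?_, hm0, ?_, ?_, ?_, fun x hx => Nat.le_floor hx, ?_⟩
  · have : (r : ℝ) ≤ n := by
      refine (le_mul_of_one_le_right hr0'.le ?_).trans hrP
      linarith [(Nat.cast_nonneg P : (0 : ℝ) ≤ P)]
    exact_mod_cast this
  · have : 2 * (k : ℝ) ≤ r := by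
      have : u * ρ ^ 13 ≤ u * ρ ^ 16 := by gcongr; norm_num
      linarith
    exact_mod_cast this
  · rw [mul_assoc]
    exact Nat.div_mul_le_self _ _
  · have : (E : ℝ) ≤ n := hE1.trans (div_le_self hn0.le (one_le_pow₀ hρ1))
    exact_mod_cast this
  · have h1 : (n : ℝ) / ρ ^ 8 < m * (L + 1) := by
      rw [div_lt_iff₀ (by positivity)]
      rw [div_lt_iff₀ (by positivity)] at hL2
      calc (n : ℝ) < 2 * m * (r * (P + 1)) := hm2
        _ ≤ 2 * m * ((L + 1) * ρ ^ 2 * (2 * ρ)) := by gcongr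
        _ = 4 * (m * (L + 1) * ρ ^ 3) := by ring
        _ ≤ ρ ^ 5 * (m * (L + 1) * ρ ^ 3) := by
          gcongr
          exact (by linarith : (4 : ℝ) ≤ ρ).trans (le_self_pow₀ hρ1 (by norm_num))
        _ = m * (L + 1) * ρ ^ 8 := by ring
    have h2 : (E : ℝ) < m * (L + 1) := hE1.trans_lt h1
    exact_mod_cast h2
  · have h1 : (P : ℝ) * (2 * M + 2 * (g * P) + 2 * l + 3) ≤
        ρ * (2 * (ρ * u) + 2 * (ρ * ρ) + 2 * ρ + 3) := by gcongr
    have h2 : (K : ℝ) * (L + 1) ≤ ρ * (r / ρ ^ 2 + 1) := by gcongr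
    have h3 : ρ * (r / ρ ^ 2 + 1) = r / ρ + ρ := by field_simp
    have h4 : (r : ℝ) / ρ ≤ r / 1000 := by gcongr
    have h5 : ρ * ρ * ρ ≤ ρ ^ 2 * u := by
      calc ρ * ρ * ρ = ρ ^ 2 * ρ := by ring
        _ ≤ _ := by gcongr
    have h6 : ρ ≤ ρ * u := le_mul_of_one_le_right hρ0.le (by linarith)
    have h7 : ρ * u ≤ ρ ^ 2 * u := by
      gcongr
      exact le_self_pow₀ hρ1 (by norm_num)
    have h8 : ρ * ρ ≤ ρ * u := by gcongr
    have h9 : 1000 * (ρ ^ 2 * u) ≤ u * ρ ^ 16 := by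
      calc 1000 * (ρ ^ 2 * u) ≤ ρ ^ 14 * (ρ ^ 2 * u) := by
            gcongr
            exact hρ.trans (le_self_pow₀ hρ1 (by norm_num))
        _ = _ := by ring
    have h10 : (2 : ℝ) + P * (2 * M + 2 * (g * P) + 2 * l + 3) + K * (L + 1) + 2 * M + 2 * l < r := by
      linarith
    exact_mod_cast h10

/-- Here h ≤ 2r²/σ^k ≤ 2r/ρ^16, so the entropy term is at most 4n/ρ^15, the logarithm costing one ρ.
The other term is at most n/ρ^31. The margin over n/ρ^8 absorbs C. -/
theorem targetBits_bound {n k r h σ : ℕ} {ρ u C : ℝ} (hρ : 1000 ≤ ρ) (hu : 0 < u)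
    (hr0 : 0 < r) (hrn : r ≤ n) (hr : (r : ℝ) ≤ u * ρ ^ 16) (hC : |C| ≤ ρ)
    (hlog : Real.logb 2 n ≤ ρ)
    (hk1 : u * ρ ^ 32 ≤ (σ : ℝ) ^ k) (hk2 : (σ : ℝ) ^ k ≤ u * ρ ^ 33)
    (hh : h * σ ^ k ≤ 2 * r ^ 2) {H : ℝ} (hH0 : 0 ≤ H)
    (hH : H ≤ (h * (n / r + 1) : ℕ) * Real.logb 2 n) :
    C * (H + (σ : ℝ) ^ k * (n / (u * ρ ^ 64))) ≤ n / ρ ^ 8 := by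
  have hρ0 : 0 < ρ := by linarith
  have hρ1 : 1 ≤ ρ := by linarith
  have hr0' : (0 : ℝ) < r := by exact_mod_cast hr0
  have hrn' : (r : ℝ) ≤ n := by exact_mod_cast hrn
  have hn0 : (0 : ℝ) < n := by linarith
  have h1 : (h : ℝ) * ρ ^ 16 ≤ 2 * r := by
    have h2 : (h : ℝ) * (σ : ℝ) ^ k ≤ 2 * r ^ 2 := by exact_mod_cast hh
    have h3 : (h : ℝ) * (u * ρ ^ 32) ≤ 2 * (r * (u * ρ ^ 16)) := by
      calc (h : ℝ) * (u * ρ ^ 32) ≤ h * (σ : ℝ) ^ k := by gcongr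
        _ ≤ 2 * r ^ 2 := h2
        _ = 2 * (r * r) := by ring
        _ ≤ _ := by gcongr
    refine le_of_mul_le_mul_right ?_ (show 0 < u * ρ ^ 16 by positivity)
    calc _ = (h : ℝ) * (u * ρ ^ 32) := by ring
      _ ≤ _ := h3
      _ = _ := by ring
  have h2 : ((h * (n / r + 1) : ℕ) : ℝ) * ρ ^ 16 ≤ 4 * n := by
    have h3 : ((n / r : ℕ) : ℝ) + 1 ≤ 2 * (n / r) := by
      have h4 : ((n / r : ℕ) : ℝ) ≤ n / r := Nat.cast_div_le
      have h5 : (1 : ℝ) ≤ n / r := by rwa [le_div_iff₀ hr0', one_mul]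
      linarith
    rw [Nat.cast_mul, Nat.cast_add, Nat.cast_one]
    calc (h : ℝ) * (((n / r : ℕ) : ℝ) + 1) * ρ ^ 16 = (h * ρ ^ 16) * (((n / r : ℕ) : ℝ) + 1) := by
          ring
      _ ≤ 2 * (r : ℝ) * (2 * (n / r)) := by gcongr
      _ = 4 * (n : ℝ) := by field_simp; norm_num
  have h3 : H * ρ ^ 15 ≤ 4 * n := by
    calc H * ρ ^ 15 ≤ (h * (n / r + 1) : ℕ) * ρ * ρ ^ 15 := by
          gcongr
          exact hH.trans (by gcongr)
      _ = (h * (n / r + 1) : ℕ) * ρ ^ 16 := by ring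
      _ ≤ _ := h2
  have h4 : (σ : ℝ) ^ k * (n / (u * ρ ^ 64)) * ρ ^ 15 ≤ n := by
    calc (σ : ℝ) ^ k * (n / (u * ρ ^ 64)) * ρ ^ 15 ≤ u * ρ ^ 33 * (n / (u * ρ ^ 64)) * ρ ^ 15 := by
          gcongr
      _ = n / ρ ^ 16 := by field_simp
      _ ≤ n := div_le_self hn0.le (one_le_pow₀ hρ1)
  rw [le_div_iff₀ (by positivity)]
  calc C * (H + (σ : ℝ) ^ k * (n / (u * ρ ^ 64))) * ρ ^ 8
      ≤ ρ * (H + (σ : ℝ) ^ k * (n / (u * ρ ^ 64))) * ρ ^ 8 := by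
        gcongr
        exact (le_abs_self C).trans hC
    _ = (H + (σ : ℝ) ^ k * (n / (u * ρ ^ 64))) * (ρ ^ 9 * 1) := by ring
    _ ≤ (H + (σ : ℝ) ^ k * (n / (u * ρ ^ 64))) * (ρ ^ 9 * (ρ ^ 6 / 5)) := by
        gcongr
        have : ρ ≤ ρ ^ 6 := le_self_pow₀ hρ1 (by norm_num)
        linarith
    _ = (H * ρ ^ 15 + (σ : ℝ) ^ k * (n / (u * ρ ^ 64)) * ρ ^ 15) / 5 := by ring
    _ ≤ n := by linarith

theorem le_pow_contextLength {σ : ℕ} (hσ : 2 ≤ σ) {c ε : ℝ} {n : ℕ} (hn : 1 ≤ n) :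
    (n : ℝ) ^ (c + ε / 2) ≤ (σ : ℝ) ^ contextLength σ c ε n := by
  have hσ' : (1 : ℝ) < σ := by exact_mod_cast hσ
  have hn' : (0 : ℝ) < n := by exact_mod_cast hn
  calc (n : ℝ) ^ (c + ε / 2) = (σ : ℝ) ^ ((c + ε / 2) * Real.logb σ n) := by
        rw [mul_comm, Real.rpow_mul (by positivity),
          Real.rpow_logb (by positivity) hσ'.ne' hn']
    _ ≤ (σ : ℝ) ^ (contextLength σ c ε n : ℝ) :=
        Real.rpow_le_rpow_of_exponent_le hσ'.le (Nat.le_ceil _)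
    _ = _ := Real.rpow_natCast _ _

/-- Rounding up costs one factor σ, later absorbed in the step from ρ^32 to ρ^33. -/
theorem pow_contextLength_le {σ : ℕ} (hσ : 2 ≤ σ) {c ε : ℝ} (h : 0 ≤ c + ε / 2) {n : ℕ}
    (hn : 1 ≤ n) : (σ : ℝ) ^ contextLength σ c ε n ≤ σ * (n : ℝ) ^ (c + ε / 2) := by
  have hσ' : (1 : ℝ) < σ := by exact_mod_cast hσ
  have hn' : (0 : ℝ) < n := by exact_mod_cast hn
  have hlog : 0 ≤ Real.logb σ n := Real.logb_nonneg hσ' (by exact_mod_cast hn)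
  calc (σ : ℝ) ^ contextLength σ c ε n = (σ : ℝ) ^ (contextLength σ c ε n : ℝ) :=
        (Real.rpow_natCast _ _).symm
    _ ≤ (σ : ℝ) ^ ((c + ε / 2) * Real.logb σ n + 1) :=
        Real.rpow_le_rpow_of_exponent_le hσ'.le (Nat.ceil_lt_add_one (by positivity)).le
    _ = σ * (n : ℝ) ^ (c + ε / 2) := by
        rw [Real.rpow_add (by positivity), Real.rpow_one, mul_comm (c + ε / 2),
          Real.rpow_mul (by positivity), Real.rpow_logb (by positivity) hσ'.ne' hn', mul_comm]

theorem logb_natCast_le_two_mul_log {σ n : ℕ} (hσ : 2 ≤ σ) :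
    Real.logb σ n ≤ 2 * Real.log n := by
  have h0 : 0 ≤ Real.log n := Real.log_natCast_nonneg n
  have h1 : (1 : ℝ) / 2 ≤ Real.log σ := by
    have h2 : Real.log 2 ≤ Real.log σ := Real.log_le_log (by norm_num) (by exact_mod_cast hσ)
    linarith [Real.log_two_gt_d9]
  rw [Real.logb, div_le_iff₀ (by linarith)]
  linarith [mul_le_mul_of_nonneg_left h1 h0]

/-- The sign is what allows a constant C of either sign to be replaced by ρ ≥ |C|. -/
theorem length_mul_Hk_nonneg {σ : ℕ} (k : ℕ) (s : List (Fin σ)) :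
    0 ≤ (s.length : ℝ) * Hk k s := by
  refine mul_nonneg (Nat.cast_nonneg _) (mul_nonneg (by positivity)
    (Finset.sum_nonneg fun w _ => ?_))
  rw [length_mul_H0]
  refine Finset.sum_nonneg fun a ha => mul_nonneg (Nat.cast_nonneg _) ?_
  have hc : 1 ≤ (followers (List.ofFn w) s).count a :=
    List.one_le_count_iff.2 (List.mem_toFinset.1 ha)
  refine Real.logb_nonneg (by norm_num) ?_
  rw [le_div_iff₀ (by exact_mod_cast hc), one_mul]
  exact_mod_cast List.count_le_length

/-! ### The lower bound -/

theorem WStreamsDecoder.eventually_exists_not_recovers {σ : ℕ} (hσ : 2 ≤ σ) {c ε : ℝ}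
    (hε : 0 < ε) (hεc : ε < c) (hc : c < 1 - ε) {Γ : Type} [Finite Γ]
    (A : ℕ → WStreamsDecoder σ Γ) (G Cmem Cpass Cbits : ℝ) (b : ℕ) :
    ∀ᶠ n : ℕ in atTop, ∃ s : List (Fin σ), s.length = n ∧
      ¬ ∃ e : List Bool, (e.length : ℝ) ≤ Cbits * targetBits c ε s ∧
        (A n).Recovers G (Cmem * (n : ℝ) ^ c) (Cpass * Real.log n ^ b) e s := by
  have := Fintype.ofFinite Γ
  -- With this exponent ρ^64 = n^ε, so ε < c and c < 1 - ε become ρ^64 ≤ u and uρ^64 ≤ n, and n^(c +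
  -- ε/2) is uρ^32.
  have hη : 0 < ε / 64 := by linarith
  set K := Fintype.card Γ + 2 with hK
  set g := ⌈|G|⌉₊ + 1 with hg
  have hGg : G + 1 ≤ g := by
    rw [hg, Nat.cast_add, Nat.cast_one]
    linarith [le_abs_self G, Nat.le_ceil |G|]
  filter_upwards [eventually_ge_atTop 1, eventually_const_le_rpow 1000 hη,
    eventually_const_le_rpow K hη, eventually_const_le_rpow g hη,
    eventually_const_le_rpow |Cmem| hη, eventually_const_le_rpow |Cbits| hη,
    eventually_const_le_rpow σ hη, eventually_mul_log_pow_le_rpow Cpass b hη,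
    eventually_mul_log_pow_le_rpow 4 1 hη] with n hn hρ hKρ hgρ hCmem hCbits hσρ hpass hlog
  set ρ := (n : ℝ) ^ (ε / 64) with hρdef
  set u := (n : ℝ) ^ c with hudef
  have hn1 : (1 : ℝ) ≤ n := by exact_mod_cast hn
  have hn0 : (0 : ℝ) < n := by linarith
  have hρ0 : 0 < ρ := by linarith
  have hu0 : 0 < u := Real.rpow_pos_of_pos hn0 _
  have hpow : ∀ a : ℕ, ρ ^ a = (n : ℝ) ^ (ε / 64 * a) := fun a => by
    rw [hρdef, ← Real.rpow_natCast, ← Real.rpow_mul hn0.le]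
  have hupow : ∀ a : ℕ, u * ρ ^ a = (n : ℝ) ^ (c + ε / 64 * a) := fun a => by
    rw [hpow, Real.rpow_add hn0]
  have hu64 : ρ ^ 64 ≤ u := by
    rw [hpow]
    exact Real.rpow_le_rpow_of_exponent_le hn1 (by push_cast; linarith)
  have hx : u * ρ ^ 64 ≤ n := by
    rw [hupow]
    conv_rhs => rw [← Real.rpow_one (n : ℝ)]
    exact Real.rpow_le_rpow_of_exponent_le hn1 (by push_cast; linarith)
  rw [pow_one] at hlog
  have hlog0 : 0 ≤ Real.log n := Real.log_natCast_nonneg n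
  have hlogσ := logb_natCast_le_two_mul_log (n := n) hσ
  have hlog2 : Real.logb 2 n ≤ 2 * Real.log n := by
    simpa using logb_natCast_le_two_mul_log (n := n) le_rfl
  have hlogσ0 : 0 ≤ Real.logb σ n :=
    Real.logb_nonneg (by exact_mod_cast hσ) hn1
  set k := contextLength σ c ε n with hkdef
  have hkρ : (k : ℝ) ≤ ρ := by
    have h1 : (k : ℝ) < (c + ε / 2) * Real.logb σ n + 1 :=
      Nat.ceil_lt_add_one (mul_nonneg (by linarith) hlogσ0)
    linarith [mul_le_of_le_one_left hlogσ0 (show c + ε / 2 ≤ 1 by linarith)]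
  have hPρ : ((⌊Cpass * Real.log n ^ b⌋₊ : ℕ) : ℝ) ≤ ρ := by
    rcases le_total 0 (Cpass * Real.log n ^ b) with h | h
    · exact (Nat.floor_le h).trans hpass
    · rw [Nat.floor_of_nonpos h]
      simpa using hρ0.le
  have hMρ : ((⌊Cmem * u⌋₊ : ℕ) : ℝ) ≤ ρ * u := by
    rcases le_total 0 (Cmem * u) with h | h
    · refine (Nat.floor_le h).trans ?_
      gcongr
      exact (le_abs_self _).trans hCmem
    · rw [Nat.floor_of_nonpos h]
      simpa using (mul_pos hρ0 hu0).le
  have hlρ : ((Nat.log 2 n + 1 : ℕ) : ℝ) ≤ ρ := by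
    have h1 : ((Nat.log 2 n : ℕ) : ℝ) ≤ Real.logb 2 n := by
      simpa using Real.natLog_le_logb n 2
    push_cast
    linarith
  obtain ⟨r, m, L, E, hr0, hrn, hru, hkr, hm0, hmn, hEn, hEm, hE, hexp⟩ :=
    exists_parameters hρ hu64 hx hkρ hPρ hMρ hgρ hKρ hlρ
  have : NeZero r := ⟨hr0.ne'⟩
  obtain ⟨t, ht, hA⟩ := (A n).exists_not_recovers hσ (G := G) hkr hGg (by omega)
    (Nat.lt_pow_succ_log_self (by norm_num) n) hrn hEn (Nat.lt_two_pow_self.le : K ≤ 2 ^ K) hm0 hmn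
    hEm hexp
  refine ⟨periodicString t n, length_periodicString t n, ?_⟩
  rintro ⟨e, he, hrec⟩
  refine hA e (hE _ (he.trans ?_)) hrec
  have hexp2 : (n : ℝ) ^ (1 - c - ε) = n / (u * ρ ^ 64) := by
    rw [hupow, sub_sub, Real.rpow_sub hn0, Real.rpow_one]
    congr 2
    push_cast
    ring
  have hk32 : u * ρ ^ 32 = (n : ℝ) ^ (c + ε / 2) := by
    rw [hupow]
    congr 1
    push_cast
    ring
  rw [targetBits, length_periodicString, ← hkdef, hexp2]
  refine targetBits_bound hρ hu0 hr0 hrn hru hCbits (by linarith) ?_ ?_ ht ?_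
    (length_mul_Hk_periodicString_le k t n)
  · rw [hk32]
    exact le_pow_contextLength hσ hn
  · refine (pow_contextLength_le hσ (by linarith) hn).trans ?_
    rw [← hk32]
    calc (σ : ℝ) * (u * ρ ^ 32) ≤ ρ * (u * ρ ^ 32) := by gcongr
      _ = u * ρ ^ 33 := by ring
  · simpa using length_mul_Hk_nonneg k (periodicString t n)

/-- The decoder may depend on `n` in an arbitrary way (and so may know `n`); a single decoder for
all lengths is the special case of a constant family. -/
theorem theorem7 (σ : ℕ) (hσ : 2 ≤ σ) (c ε : ℝ) (hε : 0 < ε) (hεc : ε < c) (hc : c < 1 - ε) :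
    (∀ (A : ℕ → MultipassDecoder σ) (Cmem Cpass Cbits : ℝ) (b : ℕ),
      ∀ᶠ n : ℕ in atTop, ∃ s : List (Fin σ), s.length = n ∧
        ¬ ∃ e : List Bool, (e.length : ℝ) ≤ Cbits * targetBits c ε s ∧
          (A n).Recovers (Cmem * (n : ℝ) ^ c) (Cpass * Real.log n ^ b) e s) ∧
    (∀ (Γ : Type) [Finite Γ] (A : ℕ → WStreamsDecoder σ Γ) (G Cmem Cpass Cbits : ℝ) (b : ℕ),
      ∀ᶠ n : ℕ in atTop, ∃ s : List (Fin σ), s.length = n ∧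
        ¬ ∃ e : List Bool, (e.length : ℝ) ≤ Cbits * targetBits c ε s ∧
          (A n).Recovers G (Cmem * (n : ℝ) ^ c) (Cpass * Real.log n ^ b) e s) := by
  refine ⟨fun A Cmem Cpass Cbits b => ?_, fun Γ _ A G Cmem Cpass Cbits b =>
    WStreamsDecoder.eventually_exists_not_recovers hσ hε hεc hc A G Cmem Cpass Cbits b⟩
  filter_upwards [WStreamsDecoder.eventually_exists_not_recovers hσ hε hεc hc
    (fun n => (A n).toWStreams) 1 Cmem Cpass Cbits b] with n hn
  obtain ⟨s, hs, h⟩ := hn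
  exact ⟨s, hs, fun ⟨e, he, hrec⟩ => h ⟨e, he, hrec.toWStreams⟩⟩
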